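/- Let $V$ be a finite set of points in the Euclidean plane. It is in convex position if no three of its points are collinear and no point of $V$ lies in the convex hull of the other points of $V$ (i.e. the points of $V$ are the vertices of a convex polygon). Let $D_V$ denote the segment disjointness graph of $V$: its vertices are the closed straight line segments joining two distinct points of $V$, and two segments are adjacent if and only if they are disjoint. For a finite graph $G$, the achromatic number $\alpha(G)$ is the largest $l$ for which there is a surjective map $\varsigma\colon V(G)\to\{1,\dots,l\}$ such that adjacent vertices get different colors and, for any two different colors $i,j$, there is an edge $xy$ of $G$ with $\varsigma(x)=i$ and $\varsigma(y)=j$. **Theorem.** For every even natural number $n$ and every set $V$ of $n$ points in convex position in the plane, $$\alpha(D_V)\ \ge\ \frac{n^2}{6}+\Theta(n).$$ That is, there is a function $g\colon\mathbb N\to\mathbb R$, depending only on $n$, such that $c\,n\le g(n)\le C\,n$ for some constants $c>0$ and $C$ and all sufficiently large $n$, and such that $\alpha(D_V)\ge \frac{n^2}{6}+g(n)$ for every even $n$ and every set $V$ of $n$ points in convex position. -/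

import Mathlib

/-- The Euclidean plane. -/
abbrev Plane : Type := EuclideanSpace ℝ (Fin 2)

/-- A complete proper `l`-coloring of `G`: a surjective coloring with colors in `Fin l` such that
adjacent vertices get different colors and any two different colors appear on the two ends of
some edge. -/
structure IsCompleteProperColoring {W : Type*} (G : SimpleGraph W) (l : ℕ) (c : W → Fin l) :
    Prop where
  surjective : Function.Surjective c
  proper : ∀ x y, G.Adj x y → c x ≠ c y
  complete : ∀ i j, i ≠ j → ∃ x y, G.Adj x y ∧ c x = i ∧ c y = j

/-- The achromatic number: the largest `l` for which `G` has a complete proper `l`-coloring.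
For a finite graph these `l` are bounded by the number of vertices, see
`bddAbove_completeProperColoring`. -/
noncomputable def achromaticNumber {W : Type*} (G : SimpleGraph W) : ℕ :=
  sSup {l : ℕ | ∃ c : W → Fin l, IsCompleteProperColoring G l c}

theorem bddAbove_completeProperColoring {W : Type*} [Finite W] (G : SimpleGraph W) :
    BddAbove {l : ℕ | ∃ c : W → Fin l, IsCompleteProperColoring G l c} := by
  refine ⟨Nat.card W, ?_⟩
  rintro l ⟨c, hc⟩
  simpa using Nat.card_le_card_of_surjective c hc.surjective

/-- General position: no three distinct points of `V` are collinear. -/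
def InGeneralPosition (V : Finset Plane) : Prop :=
  ∀ p ∈ V, ∀ q ∈ V, ∀ r ∈ V, p ≠ q → p ≠ r → q ≠ r → ¬ Collinear ℝ ({p, q, r} : Set Plane)

/-- Convex position: the points are in general position and are the vertices of their convex
hull, i.e. no point of `V` lies in the convex hull of the others. -/
def InConvexPosition (V : Finset Plane) : Prop :=
  InGeneralPosition V ∧ ConvexIndependent ℝ (Subtype.val : {p : Plane // p ∈ V} → Plane)

/-- The closed straight line segments with two distinct endpoints in `V`, each represented by
its set of endpoints. -/
abbrev SegmentOf (V : Finset Plane) : Type := {e : Finset Plane // e ∈ V.powersetCard 2}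

/-- The closed segment, as a set of points, spanned by a pair of endpoints: the convex hull of
the two endpoints. -/
def SegmentOf.points {V : Finset Plane} (e : SegmentOf V) : Set Plane :=
  convexHull ℝ (e.1 : Set Plane)

theorem SegmentOf.points_nonempty {V : Finset Plane} (e : SegmentOf V) : e.points.Nonempty := by
  have h : e.1.card = 2 := (Finset.mem_powersetCard.1 e.2).2
  have h' : e.1.Nonempty := Finset.card_pos.1 (by omega)
  exact (Finset.coe_nonempty.2 h').convexHull

/-- The segment disjointness graph of `V`: the vertices are the segments with endpoints in `V`,
and two of them are adjacent if and only if they are disjoint as sets of points of the plane. -/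
def segmentDisjointnessGraph (V : Finset Plane) : SimpleGraph (SegmentOf V) where
  Adj e f := Disjoint e.points f.points
  symm := ⟨fun _ _ h => h.symm⟩
  loopless := ⟨fun e h => e.points_nonempty.ne_empty (disjoint_self.1 h)⟩

/-! Since `n + 1` is odd, `n + 1` abstract points carry a partial triple system with at least `((n +
1) n - 8) / 6` triples, any two sharing at most one point (`Odd.exists_tripleSystem`). Deleting one
point leaves `n` points; the triples through it shrink to pairwise disjoint pairs, which can be
labelled `{2 r, 2 r + 1}` and so placed on edges of the convex polygon
(`IsPartialTripleSystem.exists_deletion`). The linear gain over `n ^ 2 / 6` comes from keeping these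
pairs as blocks.

Each block becomes a color class: the three sides of a triangle, or one polygon edge. Segments
within a class always meet. Two triangles with at most one common vertex have disjoint sides: one
has a side `ab` with both ends off the other, and the line `ab` misses a side of that other
triangle. A polygon edge is disjoint from every segment avoiding its ends
(`InConvexPosition.card_le_achromaticNumber`).

The classes need not use every segment: a complete coloring of part of a finite graph extends to the
whole graph without losing colors (`IsPartialCompleteColoring.le_achromaticNumber`). -/

/-! ### Greedy extension of complete colorings. -/

theorem IsCompleteProperColoring.le_achromaticNumber {W : Type*} [Finite W] {G : SimpleGraph W}
    {l : ℕ} {c : W → Fin l} (h : IsCompleteProperColoring G l c) : l ≤ achromaticNumber G :=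
  le_csSup (bddAbove_completeProperColoring G) ⟨c, h⟩

/-- `c` restricted to `S` is a complete proper coloring of the induced graph, with the colors
`0, …, l - 1`. -/
structure IsPartialCompleteColoring {W : Type*} (G : SimpleGraph W) (S : Set W) (l : ℕ)
    (c : W → ℕ) : Prop where
  lt : ∀ x ∈ S, c x < l
  surjective : ∀ i < l, ∃ x ∈ S, c x = i
  proper : ∀ x ∈ S, ∀ y ∈ S, G.Adj x y → c x ≠ c y
  complete : ∀ i < l, ∀ j < l, i ≠ j → ∃ x ∈ S, ∃ y ∈ S, G.Adj x y ∧ c x = i ∧ c y = j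

/-- If some color is absent from the neighbors of `w` in `S`, then `w` can take it. Otherwise `w`
sees every color, so giving it the new color `l` keeps the coloring complete. -/
theorem IsPartialCompleteColoring.exists_insert {W : Type*} {G : SimpleGraph W} {S : Set W}
    {l : ℕ} {c : W → ℕ} (h : IsPartialCompleteColoring G S l c) (w : W) :
    ∃ l' c', l ≤ l' ∧ IsPartialCompleteColoring G (insert w S) l' c' := by
  classical
  by_cases hw : w ∈ S
  · exact ⟨l, c, le_rfl, by rwa [Set.insert_eq_of_mem hw]⟩
  have upd : ∀ a, ∀ x ∈ S, Function.update c w a x = c x := fun a x hx =>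
    Function.update_of_ne (fun h => hw (by rwa [h] at hx)) _ _
  by_cases hi : ∃ i < l, ∀ x ∈ S, G.Adj w x → c x ≠ i
  · obtain ⟨i, hil, hi⟩ := hi
    refine ⟨l, Function.update c w i, le_rfl, ?_, ?_, ?_, ?_⟩
    · rintro x (rfl | hx)
      · simpa
      · rw [upd _ x hx]; exact h.lt x hx
    · intro j hj
      obtain ⟨x, hx, rfl⟩ := h.surjective j hj
      exact ⟨x, Or.inr hx, upd _ x hx⟩
    · rintro x (rfl | hx) y (rfl | hy) hxy
      · exact absurd hxy (G.irrefl)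
      · rw [upd _ y hy, Function.update_self]; exact (hi y hy hxy).symm
      · rw [upd _ x hx, Function.update_self]; exact hi x hx hxy.symm
      · rw [upd _ x hx, upd _ y hy]; exact h.proper x hx y hy hxy
    · intro j hj k hk hjk
      obtain ⟨x, hx, y, hy, hxy, rfl, rfl⟩ := h.complete j hj k hk hjk
      exact ⟨x, Or.inr hx, y, Or.inr hy, hxy, upd _ x hx, upd _ y hy⟩
  · push Not at hi
    refine ⟨l + 1, Function.update c w l, Nat.le_succ l, ?_, ?_, ?_, ?_⟩
    · rintro x (rfl | hx)
      · simp
      · rw [upd _ x hx]; exact (h.lt x hx).trans (Nat.lt_succ_self l)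
    · intro j hj
      rcases Nat.lt_succ_iff_lt_or_eq.1 hj with hj | rfl
      · obtain ⟨x, hx, rfl⟩ := h.surjective j hj
        exact ⟨x, Or.inr hx, upd _ x hx⟩
      · exact ⟨w, Or.inl rfl, by simp⟩
    · rintro x (rfl | hx) y (rfl | hy) hxy
      · exact absurd hxy (G.irrefl)
      · rw [upd _ y hy, Function.update_self]; exact (h.lt y hy).ne'
      · rw [upd _ x hx, Function.update_self]; exact (h.lt x hx).ne
      · rw [upd _ x hx, upd _ y hy]; exact h.proper x hx y hy hxy
    · intro j hj k hk hjk
      rcases Nat.lt_succ_iff_lt_or_eq.1 hj with hj | rfl <;>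
        rcases Nat.lt_succ_iff_lt_or_eq.1 hk with hk | rfl
      · obtain ⟨x, hx, y, hy, hxy, rfl, rfl⟩ := h.complete j hj k hk hjk
        exact ⟨x, Or.inr hx, y, Or.inr hy, hxy, upd _ x hx, upd _ y hy⟩
      · obtain ⟨x, hx, hwx, rfl⟩ := hi j hj
        exact ⟨x, Or.inr hx, w, Or.inl rfl, hwx.symm, upd _ x hx, by simp⟩
      · obtain ⟨x, hx, hwx, rfl⟩ := hi k hk
        exact ⟨w, Or.inl rfl, x, Or.inr hx, hwx, by simp, upd _ x hx⟩
      · exact absurd rfl hjk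

theorem IsPartialCompleteColoring.le_achromaticNumber {W : Type*} [Finite W] {G : SimpleGraph W}
    {S : Set W} {l : ℕ} {c : W → ℕ} (h : IsPartialCompleteColoring G S l c) :
    l ≤ achromaticNumber G := by
  classical
  have := Fintype.ofFinite W
  have key : ∀ T : Finset W, ∃ l' c', l ≤ l' ∧ IsPartialCompleteColoring G (↑T ∪ S) l' c' := by
    intro T
    induction T using Finset.induction_on with
    | empty => exact ⟨l, c, le_rfl, by simpa using h⟩
    | insert w T _ ih =>
      obtain ⟨l₁, c₁, h₁, hc₁⟩ := ih
      obtain ⟨l₂, c₂, h₂, hc₂⟩ := hc₁.exists_insert w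
      exact ⟨l₂, c₂, h₁.trans h₂, by rwa [Finset.coe_insert, Set.insert_union]⟩
  obtain ⟨l', c', hl, hc⟩ := key Finset.univ
  rw [Finset.coe_univ, Set.univ_union] at hc
  refine hl.trans (IsCompleteProperColoring.le_achromaticNumber
    (c := fun x => (⟨c' x, hc.lt x trivial⟩ : Fin l')) ⟨?_, ?_, ?_⟩)
  · intro i
    obtain ⟨x, -, hx⟩ := hc.surjective i i.2
    exact ⟨x, Fin.ext hx⟩
  · intro x y hxy he
    exact hc.proper x trivial y trivial hxy (Fin.ext_iff.1 he)
  · intro i j hij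
    obtain ⟨x, -, y, -, hxy, hx, hy⟩ := hc.complete i i.2 j j.2 (fun h => hij (Fin.ext h))
    exact ⟨x, y, hxy, Fin.ext hx, Fin.ext hy⟩

/-- Disjoint nonempty independent sets, any two of them joined by an edge, bound the achromatic
number from below. -/
theorem card_le_achromaticNumber {W I : Type*} [Finite W] [Fintype I] (G : SimpleGraph W)
    (K : I → Set W) (hne : ∀ i, (K i).Nonempty) (hdisj : ∀ i j x, x ∈ K i → x ∈ K j → i = j)
    (hindep : ∀ i, ∀ x ∈ K i, ∀ y ∈ K i, ¬ G.Adj x y)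
    (hcomp : ∀ i j, i ≠ j → ∃ x ∈ K i, ∃ y ∈ K j, G.Adj x y) :
    Fintype.card I ≤ achromaticNumber G := by
  classical
  let r := Fintype.equivFin I
  -- The value `0` outside the classes is irrelevant: the coloring is only used on `⋃ i, K i`.
  let c : W → ℕ := fun x => if h : ∃ i, x ∈ K i then r h.choose else 0
  have hc : ∀ i, ∀ x ∈ K i, c x = r i := by
    intro i x hx
    have h : ∃ i, x ∈ K i := ⟨i, hx⟩
    simp only [c, dif_pos h]
    rw [hdisj _ _ x h.choose_spec hx]
  have hr : ∀ i < Fintype.card I, ∃ a, (r a : ℕ) = i := fun i hi => ⟨r.symm ⟨i, hi⟩, by simp⟩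
  refine IsPartialCompleteColoring.le_achromaticNumber (S := ⋃ i, K i) (c := c) ⟨?_, ?_, ?_, ?_⟩
  · intro x hx
    obtain ⟨i, hi⟩ := Set.mem_iUnion.1 hx
    rw [hc i x hi]; exact (r i).2
  · intro i hi
    obtain ⟨a, rfl⟩ := hr i hi
    obtain ⟨x, hx⟩ := hne a
    exact ⟨x, Set.mem_iUnion.2 ⟨a, hx⟩, hc a x hx⟩
  · intro x hx y hy hxy he
    obtain ⟨i, hi⟩ := Set.mem_iUnion.1 hx
    obtain ⟨j, hj⟩ := Set.mem_iUnion.1 hy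
    rw [hc i x hi, hc j y hj] at he
    obtain rfl := r.injective (Fin.ext he)
    exact hindep i x hi y hj hxy
  · intro i hi j hj hij
    obtain ⟨a, rfl⟩ := hr i hi
    obtain ⟨b, rfl⟩ := hr j hj
    obtain ⟨x, hx, y, hy, hxy⟩ := hcomp a b (by rintro rfl; exact hij rfl)
    exact ⟨x, Set.mem_iUnion.2 ⟨a, hx⟩, y, Set.mem_iUnion.2 ⟨b, hy⟩, hxy, hc a x hx, hc b y hy⟩

/-! ### Orientation and disjoint segments. -/

/-- Twice the signed area of the triangle `a b c`. -/
def orient (a b c : Plane) : ℝ :=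
  (b 0 - a 0) * (c 1 - a 1) - (b 1 - a 1) * (c 0 - a 0)

theorem orient_swap (a b c : Plane) : orient b a c = -orient a b c := by
  simp only [orient]; ring

/-- Orientation is affine in its third argument, so the line `ab` and its open sides are convex. -/
theorem orient_combo (a b x y : Plane) {s t : ℝ} (h : s + t = 1) :
    orient a b (s • x + t • y) = s * orient a b x + t * orient a b y := by
  obtain rfl : t = 1 - s := by linarith
  simp only [orient, PiLp.add_apply, PiLp.smul_apply, smul_eq_mul]; ring

theorem collinear_of_orient_eq_zero {a b c : Plane} (hab : a ≠ b) (h : orient a b c = 0) :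
    Collinear ℝ ({a, b, c} : Set Plane) := by
  rw [collinear_iff_of_mem (p₀ := a) (by simp)]
  have hne : b 0 - a 0 ≠ 0 ∨ b 1 - a 1 ≠ 0 := by
    by_contra! hc
    apply hab
    ext i
    fin_cases i
    · simpa using (sub_eq_zero.1 hc.1).symm
    · simpa using (sub_eq_zero.1 hc.2).symm
  have hr : ∃ r : ℝ, c 0 = r * (b 0 - a 0) + a 0 ∧ c 1 = r * (b 1 - a 1) + a 1 := by
    unfold orient at h
    rcases hne with hne | hne
    · refine ⟨(c 0 - a 0) / (b 0 - a 0), by field_simp; ring, ?_⟩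
      field_simp; linarith
    · refine ⟨(c 1 - a 1) / (b 1 - a 1), ?_, by field_simp; ring⟩
      field_simp; linarith
  obtain ⟨r, h0, h1⟩ := hr
  refine ⟨b - a, ?_⟩
  rintro p (rfl | rfl | rfl)
  · exact ⟨0, by simp⟩
  · exact ⟨1, by simp⟩
  · refine ⟨r, ?_⟩
    ext i
    fin_cases i
    · simpa using h0
    · simpa using h1

theorem InGeneralPosition.orient_ne_zero {V : Finset Plane} (hV : InGeneralPosition V)
    {a b c : Plane} (ha : a ∈ V) (hb : b ∈ V) (hc : c ∈ V) (hab : a ≠ b) (hac : a ≠ c)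
    (hbc : b ≠ c) : orient a b c ≠ 0 := fun h =>
  hV a ha b hb c hc hab hac hbc (collinear_of_orient_eq_zero hab h)

theorem disjoint_convexHull_pair_of_orient_pos {a b c d : Plane} (hc : 0 < orient a b c)
    (hd : 0 < orient a b d) :
    Disjoint (convexHull ℝ ({a, b} : Set Plane)) (convexHull ℝ ({c, d} : Set Plane)) := by
  have h₁ : convexHull ℝ ({a, b} : Set Plane) ⊆ {x | orient a b x = 0} := by
    refine convexHull_min ?_ ?_
    · rintro x (rfl | rfl) <;> simp only [orient, Set.mem_ofPred_eq] <;> ring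
    · intro x hx y hy s t _ _ hst
      simp only [Set.mem_ofPred_eq] at hx hy ⊢
      rw [orient_combo _ _ _ _ hst, hx, hy]; ring
  have h₂ : convexHull ℝ ({c, d} : Set Plane) ⊆ {x | 0 < orient a b x} := by
    refine convexHull_min ?_ ?_
    · rintro x (rfl | rfl) <;> assumption
    · intro x hx y hy s t hs ht hst
      simp only [Set.mem_ofPred_eq] at hx hy ⊢
      rw [orient_combo _ _ _ _ hst]
      rcases hs.eq_or_lt with rfl | hs
      · obtain rfl : t = 1 := by linarith
        simpa
      · have := mul_pos hs hx
        have := mul_nonneg ht hy.le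
        linarith
  exact Set.disjoint_left.2 fun x hx hx' => (h₂ hx').ne' (h₁ hx)

theorem disjoint_convexHull_pair_of_orient_mul_pos {a b c d : Plane}
    (h : 0 < orient a b c * orient a b d) :
    Disjoint (convexHull ℝ ({a, b} : Set Plane)) (convexHull ℝ ({c, d} : Set Plane)) := by
  rcases pos_and_pos_or_neg_and_neg_of_mul_pos h with ⟨hc, hd⟩ | ⟨hc, hd⟩
  · exact disjoint_convexHull_pair_of_orient_pos hc hd
  · rw [Set.pair_comm a b]
    apply disjoint_convexHull_pair_of_orient_pos <;> rw [orient_swap] <;> linarith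

/-- A line through no vertex of a triangle misses one of its sides. -/
theorem exists_side_disjoint {a b p q r : Plane} (hp : orient a b p ≠ 0) (hq : orient a b q ≠ 0)
    (hr : orient a b r ≠ 0) :
    0 < orient a b p * orient a b q ∨ 0 < orient a b p * orient a b r ∨
      0 < orient a b q * orient a b r := by
  rcases lt_or_gt_of_ne hp with hp | hp <;> rcases lt_or_gt_of_ne hq with hq | hq <;>
    rcases lt_or_gt_of_ne hr with hr | hr <;>
    first
    | exact Or.inl (mul_pos_of_neg_of_neg hp hq)
    | exact Or.inl (mul_pos hp hq)
    | exact Or.inr (Or.inl (mul_pos_of_neg_of_neg hp hr))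
    | exact Or.inr (Or.inl (mul_pos hp hr))
    | exact Or.inr (Or.inr (mul_pos_of_neg_of_neg hq hr))
    | exact Or.inr (Or.inr (mul_pos hq hr))

/-- The barycentric coordinates of `b` in the triangle `o a c` are `-orient a b c`, `orient o b c`
and `orient o a b`, divided by `orient o a c`. The last two are positive, so `b` lies in the
triangle unless the first is negative. -/
theorem orient_pos_of_not_mem_convexHull {o a b c : Plane} (hab : 0 < orient o a b)
    (hbc : 0 < orient o b c) (hac : 0 < orient o a c)
    (hb : b ∉ convexHull ℝ ({o, a, c} : Set Plane)) : 0 < orient a b c := by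
  by_contra! h
  apply hb
  have h₁ : o ∈ convexHull ℝ ({o, a, c} : Set Plane) := subset_convexHull _ _ (by simp)
  have h₂ : a ∈ convexHull ℝ ({o, a, c} : Set Plane) := subset_convexHull _ _ (by simp)
  have h₃ : c ∈ convexHull ℝ ({o, a, c} : Set Plane) := subset_convexHull _ _ (by simp)
  have hcv := convex_convexHull ℝ ({o, a, c} : Set Plane)
  have hsum : -orient a b c / orient o a c + orient o b c / orient o a c
      + orient o a b / orient o a c = 1 := by
    field_simp; simp only [orient]; ring
  have hmem := hcv.sum_mem (t := (Finset.univ : Finset (Fin 3)))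
    (w := ![-orient a b c / orient o a c, orient o b c / orient o a c,
      orient o a b / orient o a c]) (z := ![o, a, c])
    (by
      intro i _
      fin_cases i
      · exact div_nonneg (by linarith) hac.le
      · exact div_nonneg hbc.le hac.le
      · exact div_nonneg hab.le hac.le)
    (by simpa [Fin.sum_univ_three] using hsum)
    (by intro i _; fin_cases i <;> assumption)
  have hb' : ∀ i : Fin 2, (-orient a b c / orient o a c) * o i
      + (orient o b c / orient o a c) * a i + (orient o a b / orient o a c) * c i = b i := by
    intro i
    fin_cases i <;> field_simp <;> simp only [orient, Fin.zero_eta, Fin.mk_one] <;> ring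
  convert hmem using 1
  ext i
  simpa [Fin.sum_univ_three] using (hb' i).symm

/-! ### Counterclockwise enumeration. -/

/-- A set in convex position has an enumeration in counterclockwise order. -/
theorem InConvexPosition.exists_enumeration {V : Finset Plane} (hV : InConvexPosition V) :
    ∃ e : Fin V.card ≃ {p // p ∈ V}, ∀ i j k, i < j → j < k →
      0 < orient (e i).1 (e j).1 (e k).1 := by
  classical
  rcases V.eq_empty_or_nonempty with rfl | ⟨o, ho⟩
  · exact ⟨(Finset.equivFin _).symm, fun i => i.elim0⟩
  obtain ⟨hgen, hconv⟩ := hV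
  have hout : ∀ b ∈ V, ∀ S : Set Plane, S ⊆ V → b ∉ S → b ∉ convexHull ℝ S := by
    intro b hb S hS hbS hmem
    rw [convexIndependent_set_iff_notMem_convexHull_sdiff] at hconv
    refine hconv b hb (convexHull_mono ?_ hmem)
    exact fun x hx => ⟨hS hx, fun h => hbS (h ▸ hx)⟩
  have hoV := hout o ho (↑(V.erase o)) (by simp) (by simp)
  -- Separating `o` from the hull of the other points puts all directions from `o` in an open
  -- half-plane, where they are linearly ordered by angle.
  obtain ⟨f, u, hfu, hf⟩ := geometric_hahn_banach_point_closed (convex_convexHull ℝ _)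
    ((V.erase o).finite_toSet.isCompact_convexHull (𝕜 := ℝ)).isClosed hoV
  have hpos : ∀ x ∈ V, x ≠ o → 0 < f (x - o) := by
    intro x hx hxo
    have := hf x (subset_convexHull _ _ (by simp [hx, hxo]))
    rw [map_sub]; linarith
  set α := f (EuclideanSpace.single 0 1)
  set β := f (EuclideanSpace.single 1 1)
  have hfx : ∀ x : Plane, f x = x 0 * α + x 1 * β := by
    intro x
    have : x = x 0 • EuclideanSpace.single 0 (1 : ℝ) + x 1 • EuclideanSpace.single 1 (1 : ℝ) := by
      ext i; fin_cases i <;> simp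
    conv_lhs => rw [this]
    simp [α, β]
  -- `g` is `f` turned by a quarter turn, so `g / f` is the tangent of the angle measured from the
  -- direction `(α, β)`.
  let g : Plane → ℝ := fun x => x 1 * α - x 0 * β
  have hfg : ∀ a b : Plane, f (a - o) * g (b - o) - f (b - o) * g (a - o)
      = (α ^ 2 + β ^ 2) * orient o a b := by
    intro a b
    simp only [hfx, g, orient, PiLp.sub_apply]; ring
  let s : Plane → ℝ := fun x => g (x - o) / f (x - o)
  have horient : ∀ a ∈ V, ∀ b ∈ V, a ≠ o → b ≠ o → (0 < orient o a b ↔ s a < s b) := by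
    intro a ha b hb hao hbo
    have h1 := hpos a ha hao
    have h2 := hpos b hb hbo
    have hαβ : 0 < α ^ 2 + β ^ 2 := by
      rcases eq_or_ne α 0 with h | h
      · rcases eq_or_ne β 0 with h' | h'
        · rw [hfx, h, h'] at h1; simp at h1
        · positivity
      · positivity
    simp only [s]
    rw [div_lt_div_iff₀ h1 h2, ← mul_pos_iff_of_pos_left hαβ, ← hfg a b]
    constructor <;> intro h <;> linarith
  -- The base point `o` has no angle; `⊥` makes it the first point.
  let key : {p // p ∈ V} → WithBot ℝ := fun x => if x.1 = o then ⊥ else (s x.1 : WithBot ℝ)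
  have hkey : Function.Injective key := by
    rintro ⟨x, hx⟩ ⟨y, hy⟩ hxy
    by_cases hxo : x = o <;> by_cases hyo : y = o <;> simp only [key, hxo, hyo, if_true,
      if_false, WithBot.coe_ne_bot, WithBot.bot_ne_coe, WithBot.coe_inj] at hxy ⊢
    by_contra hne
    have hne : x ≠ y := fun h => hne (Subtype.ext h)
    rcases lt_or_gt_of_ne (hgen.orient_ne_zero ho hx hy (Ne.symm hxo) (Ne.symm hyo) hne) with h | h
    · have h' : 0 < orient o y x := by
        have : orient o y x = - orient o x y := by simp only [orient]; ring
        linarith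
      exact ((horient y hy x hx hyo hxo).1 h').ne hxy.symm
    · exact ((horient x hx y hy hxo hyo).1 h).ne hxy
  let : LinearOrder {p // p ∈ V} := LinearOrder.lift' key hkey
  have hlt : ∀ x y : {p // p ∈ V}, x < y ↔ key x < key y := fun _ _ => Iff.rfl
  have hno : ∀ x y : {p // p ∈ V}, x < y → y.1 ≠ o := by
    intro x y h hy
    rw [hlt] at h
    simp [key, hy] at h
  have hbase : ∀ x y : {p // p ∈ V}, x.1 ≠ o → x < y → 0 < orient o x.1 y.1 := by
    intro x y hx h
    have hy := hno x y h
    rw [horient _ x.2 _ y.2 hx hy]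
    rw [hlt] at h
    simpa [key, hx, hy] using h
  have hall : ∀ x y z : {p // p ∈ V}, x < y → y < z → 0 < orient x.1 y.1 z.1 := by
    intro x y z hxy hyz
    have hy := hno x y hxy
    by_cases hx : x.1 = o
    · rw [hx]; exact hbase y z hy hyz
    · refine orient_pos_of_not_mem_convexHull (hbase x y hx hxy) (hbase y z hy hyz)
        (hbase x z hx (hxy.trans hyz)) (hout _ y.2 _ ?_ ?_)
      · rintro p (rfl | rfl | rfl)
        exacts [ho, x.2, z.2]
      · rintro (h | h | h)
        · exact hy h
        · exact hxy.ne (Subtype.ext h.symm)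
        · exact hyz.ne (Subtype.ext h)
  let e := monoEquivOfFin {p // p ∈ V} (k := V.card) (by simp)
  exact ⟨e.toEquiv, fun i j k hij hjk => hall _ _ _ (e.strictMono hij) (e.strictMono hjk)⟩

/-! ### Triple systems on three layers of an abelian group. -/

/-- Triples of points, indexed by `I`, such that two distinct points lie in at most one of them. -/
structure IsPartialTripleSystem {I P : Type*} (t : I → Finset P) : Prop where
  card_eq : ∀ i, (t i).card = 3
  index_unique : ∀ i j a b, a ≠ b → a ∈ t i → b ∈ t i → a ∈ t j → b ∈ t j → i = j

theorem Finset.eq_of_card_two_of_mem {α : Type*} {s s' : Finset α} {x y : α}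
    (hs : s.card = 2) (hs' : s'.card = 2) (hxy : x ≠ y) (hx : x ∈ s) (hy : y ∈ s) (hx' : x ∈ s')
    (hy' : y ∈ s') : s = s' := by
  classical
  have h : ({x, y} : Finset α).card = 2 := Finset.card_pair hxy
  have h₁ : {x, y} = s := Finset.eq_of_subset_of_card_le
    (by rw [Finset.insert_subset_iff, Finset.singleton_subset_iff]; exact ⟨hx, hy⟩) (by omega)
  have h₂ : {x, y} = s' := Finset.eq_of_subset_of_card_le
    (by rw [Finset.insert_subset_iff, Finset.singleton_subset_iff]; exact ⟨hx', hy'⟩) (by omega)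
  exact h₁.symm.trans h₂

theorem Finset.exists_sum_eq_add_of_card_two {α : Type*} [AddCommMonoid α] {s : Finset α} {x : α}
    (hs : s.card = 2) (hx : x ∈ s) : ∃ y ∈ s, x ≠ y ∧ ∑ z ∈ s, z = x + y := by
  classical
  obtain ⟨y, hy, hyx⟩ := Finset.exists_mem_ne (by omega : 1 < s.card) x
  refine ⟨y, hy, hyx.symm, ?_⟩
  rw [← Finset.sum_pair (f := fun z : α => z) hyx.symm]
  congr 1
  exact Finset.eq_of_card_two_of_mem hs (Finset.card_pair hyx.symm) hyx.symm hx hy (by simp)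
    (by simp)

section Layers

/-- The triple `(x, i), (y, i), (f i (x + y), i + 1)` for `s = {x, y}`. -/
def mixedTriple {A : Type*} [AddCommGroup A] [DecidableEq A] (E : Type*) [DecidableEq E]
    (f : Fin 3 → A → A) (q : Fin 3 × {s : Finset A // s.card = 2}) : Finset (A × Fin 3 ⊕ E) :=
  insert (Sum.inl (f q.1 (∑ z ∈ q.2.1, z), q.1 + 1)) (q.2.1.image fun x => Sum.inl (x, q.1))

/-- The pairs of points which are not covered by mixed triples. -/
def IsDiagonal {A E : Type*} [AddCommGroup A] (f : Fin 3 → A → A) :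
    A × Fin 3 ⊕ E → A × Fin 3 ⊕ E → Prop
  | Sum.inl a, Sum.inl b => a.2 ≠ b.2 ∧ (b.2 = a.2 + 1 → b.1 = f a.2 (a.1 + a.1)) ∧
      (a.2 = b.2 + 1 → a.1 = f b.2 (b.1 + b.1))
  | _, _ => True

variable {A E J : Type*} [AddCommGroup A] [DecidableEq A] [DecidableEq E]

theorem mem_mixedTriple {f : Fin 3 → A → A}
    {q : Fin 3 × {s : Finset A // s.card = 2}} {a : A × Fin 3 ⊕ E} :
    a ∈ mixedTriple E f q ↔ ∃ x l, a = Sum.inl (x, l) ∧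
      (l = q.1 + 1 ∧ x = f q.1 (∑ z ∈ q.2.1, z) ∨ l = q.1 ∧ x ∈ q.2.1) := by
  simp only [mixedTriple, Finset.mem_insert, Finset.mem_image]
  constructor
  · rintro (rfl | ⟨x, hx, rfl⟩)
    · exact ⟨_, _, rfl, Or.inl ⟨rfl, rfl⟩⟩
    · exact ⟨_, _, rfl, Or.inr ⟨rfl, hx⟩⟩
  · rintro ⟨x, l, rfl, ⟨rfl, rfl⟩ | ⟨rfl, hx⟩⟩
    · exact Or.inl rfl
    · exact Or.inr ⟨x, hx, rfl⟩

theorem card_mixedTriple {f : Fin 3 → A → A} (q : Fin 3 × {s : Finset A // s.card = 2}) :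
    (mixedTriple E f q).card = 3 := by
  rw [mixedTriple, Finset.card_insert_of_notMem, Finset.card_image_of_injective, q.2.2]
  · intro x y h
    simpa using h
  · intro h
    obtain ⟨x, -, hx⟩ := Finset.mem_image.1 h
    have : q.1 = q.1 + 1 := (Prod.ext_iff.1 (Sum.inl.inj hx)).2
    omega

/-- Two points in one layer are the pair `s` itself. Points in layers `i` and `i + 1` determine `i`,
because the layers are cyclic of length three, and then `f i (x + y)` and `x` determine `y` by
injectivity and cancellation. -/
theorem mixedTriple_index_unique {f : Fin 3 → A → A} (hf : ∀ i, Function.Injective (f i))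
    {q q' : Fin 3 × {s : Finset A // s.card = 2}} {a b : A × Fin 3 ⊕ E} (hab : a ≠ b)
    (ha : a ∈ mixedTriple E f q) (hb : b ∈ mixedTriple E f q)
    (ha' : a ∈ mixedTriple E f q') (hb' : b ∈ mixedTriple E f q') : q = q' := by
  obtain ⟨i, s, hs⟩ := q
  obtain ⟨j, s', hs'⟩ := q'
  have key : ∀ x : A, x ∈ s → x ∈ s' → f i (∑ z ∈ s, z) = f i (∑ z ∈ s', z) → s = s' := by
    intro x hx hx' h
    obtain ⟨u, hu, hxu, hsum⟩ := Finset.exists_sum_eq_add_of_card_two hs hx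
    obtain ⟨u', hu', hxu', hsum'⟩ := Finset.exists_sum_eq_add_of_card_two hs' hx'
    have := hf i h
    rw [hsum, hsum'] at this
    obtain rfl := add_left_cancel this
    exact Finset.eq_of_card_two_of_mem hs hs' hxu hx hu hx' hu'
  obtain ⟨x, l, rfl, h₁⟩ := mem_mixedTriple.1 ha
  obtain ⟨x', l', hx, h₂⟩ := mem_mixedTriple.1 ha'
  obtain ⟨rfl, rfl⟩ := Prod.mk.inj (Sum.inl.inj hx)
  obtain ⟨y, m, rfl, h₃⟩ := mem_mixedTriple.1 hb
  obtain ⟨y', m', hy, h₄⟩ := mem_mixedTriple.1 hb'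
  obtain ⟨rfl, rfl⟩ := Prod.mk.inj (Sum.inl.inj hy)
  suffices h : i = j ∧ s = s' by obtain ⟨rfl, rfl⟩ := h; rfl
  dsimp only at h₁ h₂ h₃ h₄
  rcases h₁ with ⟨l₁, h₁⟩ | ⟨l₁, h₁⟩ <;> rcases h₃ with ⟨l₃, h₃⟩ | ⟨l₃, h₃⟩
  · exact absurd (by rw [l₁, l₃, h₁, h₃]) hab
  · rcases h₂ with ⟨l₂, h₂⟩ | ⟨l₂, h₂⟩ <;> rcases h₄ with ⟨l₄, h₄⟩ | ⟨l₄, h₄⟩ <;> try omega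
    obtain rfl : i = j := by omega
    exact ⟨rfl, key y h₃ h₄ (by rw [← h₁, ← h₂])⟩
  · rcases h₂ with ⟨l₂, h₂⟩ | ⟨l₂, h₂⟩ <;> rcases h₄ with ⟨l₄, h₄⟩ | ⟨l₄, h₄⟩ <;> try omega
    obtain rfl : i = j := by omega
    exact ⟨rfl, key x h₁ h₂ (by rw [← h₃, ← h₄])⟩
  · rcases h₂ with ⟨l₂, h₂⟩ | ⟨l₂, h₂⟩ <;> rcases h₄ with ⟨l₄, h₄⟩ | ⟨l₄, h₄⟩ <;> try omega
    · exact absurd (by rw [h₂, h₄, l₂, l₄]) hab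
    · obtain rfl : i = j := by omega
      refine ⟨rfl, Finset.eq_of_card_two_of_mem hs hs' ?_ h₁ h₃ h₂ h₄⟩
      rintro rfl
      exact hab (by rw [l₁, l₃])

/-- Covering a diagonal pair would need `f i (x + y) = f i (x + x)` with `y ≠ x`. -/
theorem not_mem_mixedTriple_of_isDiagonal {f : Fin 3 → A → A} (hf : ∀ i, Function.Injective (f i))
    {q : Fin 3 × {s : Finset A // s.card = 2}} {a b : A × Fin 3 ⊕ E} (hab : a ≠ b)
    (hd : IsDiagonal f a b) (ha : a ∈ mixedTriple E f q) (hb : b ∈ mixedTriple E f q) : False := by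
  obtain ⟨i, s, hs⟩ := q
  have key : ∀ x : A, x ∈ s → f i (∑ z ∈ s, z) ≠ f i (x + x) := by
    intro x hx h
    obtain ⟨u, hu, hxu, hsum⟩ := Finset.exists_sum_eq_add_of_card_two hs hx
    have := hf i h
    rw [hsum] at this
    exact hxu (add_left_cancel this).symm
  obtain ⟨x, l, rfl, h₁⟩ := mem_mixedTriple.1 ha
  obtain ⟨y, m, rfl, h₃⟩ := mem_mixedTriple.1 hb
  obtain ⟨d₁, d₂, d₃⟩ := hd
  dsimp only at h₁ h₃ d₁ d₂ d₃
  rcases h₁ with ⟨rfl, h₁⟩ | ⟨rfl, h₁⟩ <;> rcases h₃ with ⟨rfl, h₃⟩ | ⟨rfl, h₃⟩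
  · exact d₁ rfl
  · exact key y h₃ (h₁.symm.trans (d₃ rfl))
  · exact key x h₁ (h₃.symm.trans (d₂ rfl))
  · exact d₁ rfl

theorem isPartialTripleSystem_sumElim {f : Fin 3 → A → A} (hf : ∀ i, Function.Injective (f i))
    {u : J → Finset (A × Fin 3 ⊕ E)} (hu : IsPartialTripleSystem u)
    (hd : ∀ j, ∀ a ∈ u j, ∀ b ∈ u j, a ≠ b → IsDiagonal f a b) :
    IsPartialTripleSystem (Sum.elim (mixedTriple E f) u) := by
  refine ⟨?_, ?_⟩
  · rintro (q | j)
    exacts [card_mixedTriple q, hu.card_eq j]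
  · rintro (q | j) (q' | j') a b hab ha hb ha' hb'
    · exact congrArg _ (mixedTriple_index_unique hf hab ha hb ha' hb')
    · exact (not_mem_mixedTriple_of_isDiagonal hf hab (hd j' a ha' b hb' hab) ha hb).elim
    · exact (not_mem_mixedTriple_of_isDiagonal hf hab (hd j a ha b hb hab) ha' hb').elim
    · exact congrArg _ (hu.index_unique j j' a b hab ha hb ha' hb')

end Layers

theorem two_mul_card_mixedTriple_index (A : Type*) [Fintype A] :
    2 * Fintype.card (Fin 3 × {s : Finset A // s.card = 2})
      + 3 * Fintype.card A = 3 * Fintype.card A ^ 2 := by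
  rw [Fintype.card_prod, Fintype.card_fin, Fintype.card_finset_len]
  have h := Nat.choose_two_right (Fintype.card A)
  have h' := Nat.div_mul_cancel (Nat.even_mul_pred_self (Fintype.card A)).two_dvd
  rw [← h] at h'
  rcases Nat.eq_zero_or_pos (Fintype.card A) with h0 | h0
  · simp [h0]
  · obtain ⟨k, hk⟩ := Nat.exists_eq_succ_of_ne_zero h0.ne'
    rw [hk] at h' ⊢
    simp only [Nat.succ_eq_add_one, Nat.add_sub_cancel] at h' ⊢
    nlinarith

theorem IsDiagonal.symm {A E : Type*} [AddCommGroup A] {f : Fin 3 → A → A} {a b : A × Fin 3 ⊕ E}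
    (h : IsDiagonal f a b) : IsDiagonal f b a := by
  rcases a with a | a <;> rcases b with b | b
  · exact ⟨h.1.symm, h.2.2, h.2.1⟩
  all_goals trivial

/-! ### Triple systems of each odd order, by residue modulo 6. -/

theorem ZMod.add_self_mul_half (k : ℕ) (x : ZMod (2 * k + 1)) : (x + x) * (k + 1 : ℕ) = x := by
  have h : ((2 * k + 1 : ℕ) : ZMod (2 * k + 1)) = 0 := ZMod.natCast_self _
  push_cast at h ⊢
  linear_combination x * h

theorem ZMod.mul_half_injective (k : ℕ) :
    Function.Injective fun x : ZMod (2 * k + 1) => x * (k + 1 : ℕ) := by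
  have h : ((2 * k + 1 : ℕ) : ZMod (2 * k + 1)) = 0 := ZMod.natCast_self _
  intro x y hxy
  push_cast at hxy h
  linear_combination 2 * hxy - (x - y) * h

theorem ZMod.natCast_inj_of_lt {m a b : ℕ} (ha : a < m) (hb : b < m)
    (h : (a : ZMod m) = b) : a = b := by
  rw [ZMod.natCast_eq_natCast_iff'] at h
  rwa [Nat.mod_eq_of_lt ha, Nat.mod_eq_of_lt hb] at h

/-- Bose's Steiner triple systems of order `6 k + 3`. -/
theorem exists_tripleSystem_three_mod_six (k : ℕ) :
    ∃ (I P : Type) (_ : Fintype I) (_ : Fintype P) (t : I → Finset P),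
      IsPartialTripleSystem t ∧ Fintype.card P = 6 * k + 3 ∧
        (6 * k + 3) * (6 * k + 2) = 6 * Fintype.card I := by
  let f : Fin 3 → ZMod (2 * k + 1) → ZMod (2 * k + 1) := fun _ x => x * (k + 1 : ℕ)
  -- With `f` halving, `f (x + x) = x`, so the uncovered pairs form the vertical triples.
  let u : ZMod (2 * k + 1) → Finset (ZMod (2 * k + 1) × Fin 3 ⊕ Empty) :=
    fun x => Finset.univ.image fun l => Sum.inl (x, l)
  have hu : ∀ x a, a ∈ u x ↔ ∃ l, a = Sum.inl (x, l) := fun x a => by simp [u, eq_comm]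
  refine ⟨_, _, inferInstance, inferInstance, Sum.elim (mixedTriple Empty f) u,
    isPartialTripleSystem_sumElim (fun _ => ZMod.mul_half_injective k) ⟨?_, ?_⟩ ?_, ?_, ?_⟩
  · intro x
    rw [Finset.card_image_of_injective]
    · rfl
    · intro l l' h
      simpa using h
  · intro x y a b _ ha _ ha' _
    obtain ⟨l, rfl⟩ := (hu x a).1 ha
    obtain ⟨l', h⟩ := (hu y _).1 ha'
    exact (Prod.ext_iff.1 (Sum.inl.inj h)).1
  · intro x a ha b hb hab
    obtain ⟨l, rfl⟩ := (hu x a).1 ha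
    obtain ⟨l', rfl⟩ := (hu x b).1 hb
    have h := ZMod.add_self_mul_half k x
    exact ⟨fun hl => hab (by rw [show l = l' from hl]), fun _ => h.symm, fun _ => h.symm⟩
  · simp [ZMod.card]; ring
  · have h := two_mul_card_mixedTriple_index (ZMod (2 * k + 1))
    rw [Fintype.card_sum, ZMod.card] at *
    linarith

/-- Skolem's Steiner triple systems of order `6 k + 1`. -/
theorem exists_tripleSystem_one_mod_six (k : ℕ) (hk : 0 < k) :
    ∃ (I P : Type) (_ : Fintype I) (_ : Fintype P) (t : I → Finset P),
      IsPartialTripleSystem t ∧ Fintype.card P = 6 * k + 1 ∧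
        (6 * k + 1) * (6 * k) = 6 * Fintype.card I := by
  have : NeZero (2 * k) := ⟨by omega⟩
  -- A substitute for halving in even order: `2 j ↦ j` and `2 j + 1 ↦ j + k`. As `x` and `x + k`
  -- have the same double, both diagonal values equal `x` for `x < k`.
  let f : Fin 3 → ZMod (2 * k) → ZMod (2 * k) :=
    fun _ x => ((x.val / 2 + x.val % 2 * k : ℕ) : ZMod (2 * k))
  have hf : ∀ i, Function.Injective (f i) := by
    intro i x y hxy
    have hx := x.val_lt
    have hy := y.val_lt
    apply ZMod.val_injective
    rcases Nat.mod_two_eq_zero_or_one x.val with h | h <;>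
      rcases Nat.mod_two_eq_zero_or_one y.val with h' | h' <;>
      · simp only [f, h, h'] at hxy
        have := ZMod.natCast_inj_of_lt (by omega) (by omega) hxy
        omega
  have hf₁ : ∀ i, ∀ x < k, f i ((x : ZMod (2 * k)) + x) = x := by
    intro i x hx
    have h : ((x : ZMod (2 * k)) + x).val = 2 * x := by
      rw [← Nat.cast_add, ZMod.val_natCast, Nat.mod_eq_of_lt (by omega)]; ring
    simp only [f, h]
    rw [Nat.mul_div_cancel_left x two_pos, Nat.mul_mod_right, zero_mul, add_zero]
  have hk2 : ((2 * k : ℕ) : ZMod (2 * k)) = 0 := ZMod.natCast_self _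
  have hf₂ : ∀ i, ∀ x < k, f i (((x + k : ℕ) : ZMod (2 * k)) + (x + k : ℕ)) = x := by
    intro i x hx
    have h : ((x + k : ℕ) : ZMod (2 * k)) + (x + k : ℕ) = x + x := by
      push_cast at hk2 ⊢
      linear_combination hk2
    rw [h, hf₁ i x hx]
  have hinj : ∀ x < 2 * k, ∀ y < 2 * k, (x : ZMod (2 * k)) = y → x = y :=
    fun x hx y hy h => ZMod.natCast_inj_of_lt hx hy h
  -- Vertical triples exist only over `x < k`. The remaining diagonal pairs `(x + k, i), (x, i + 1)`
  -- are pairwise disjoint and are all joined to one extra point.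
  let u : Fin k ⊕ Fin 3 × Fin k → Finset (ZMod (2 * k) × Fin 3 ⊕ Unit) := Sum.elim
    (fun x => Finset.univ.image fun l => Sum.inl (((x : ℕ) : ZMod (2 * k)), l))
    (fun q => {Sum.inr (), Sum.inl (((q.2 + k : ℕ) : ZMod (2 * k)), q.1),
      Sum.inl (((q.2 : ℕ) : ZMod (2 * k)), q.1 + 1)})
  have hu₁ : ∀ x a, a ∈ u (Sum.inl x) ↔ ∃ l, a = Sum.inl (((x : ℕ) : ZMod (2 * k)), l) :=
    fun x a => by simp [u, eq_comm]
  have hu₂ : ∀ i x a, a ∈ u (Sum.inr (i, x)) ↔ a = Sum.inr () ∨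
      a = Sum.inl (((x + k : ℕ) : ZMod (2 * k)), i) ∨
      a = Sum.inl (((x : ℕ) : ZMod (2 * k)), i + 1) := fun i x a => by simp [u]
  have hsum : ∀ x < 2 * k, ∀ y < 2 * k, ∀ l m : Fin 3,
      (Sum.inl ((x : ZMod (2 * k)), l) : ZMod (2 * k) × Fin 3 ⊕ Unit) = Sum.inl ((y : ZMod (2 * k)), m)
        → x = y ∧ l = m := by
    intro x hx y hy l m h
    obtain ⟨h₁, h₂⟩ := Prod.mk.inj (Sum.inl.inj h)
    exact ⟨hinj x hx y hy h₁, h₂⟩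
  have hmix : ∀ (x : Fin k) (i : Fin 3) (y : Fin k) a b, a ≠ b → a ∈ u (Sum.inl x) →
      b ∈ u (Sum.inl x) → a ∈ u (Sum.inr (i, y)) → b ∈ u (Sum.inr (i, y)) → False := by
    intro x i y a b hab ha hb ha' hb'
    have hx := x.2
    have hy := y.2
    obtain ⟨l, rfl⟩ := (hu₁ _ _).1 ha
    obtain ⟨m, rfl⟩ := (hu₁ _ _).1 hb
    rcases (hu₂ _ _ _).1 ha' with h | h | h
    · cases h
    · have := hsum _ (by omega) _ (by omega) _ _ h; omega
    · rcases (hu₂ _ _ _).1 hb' with h' | h' | h'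
      · cases h'
      · have := hsum _ (by omega) _ (by omega) _ _ h'; omega
      · exact hab (h.trans h'.symm)
  refine ⟨_, _, inferInstance, inferInstance, Sum.elim (mixedTriple Unit f) u,
    isPartialTripleSystem_sumElim hf ⟨?_, ?_⟩ ?_, ?_, ?_⟩
  · rintro (x | ⟨i, x⟩)
    · simp only [u, Sum.elim_inl]
      rw [Finset.card_image_of_injective]
      · rfl
      · intro l l' h
        simpa using h
    · simp only [u, Sum.elim_inr]
      rw [Finset.card_insert_of_notMem (by simp), Finset.card_pair]
      intro h
      have := (Prod.mk.inj (Sum.inl.inj h)).2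
      omega
  · rintro (x | ⟨i, x⟩) (y | ⟨j, y⟩) a b hab ha hb ha' hb'
    · have hx := x.2
      have hy := y.2
      obtain ⟨l, rfl⟩ := (hu₁ _ _).1 ha
      obtain ⟨l', h⟩ := (hu₁ _ _).1 ha'
      exact congrArg _ (Fin.ext (hsum _ (by omega) _ (by omega) _ _ h).1)
    · exact (hmix x j y a b hab ha hb ha' hb').elim
    · exact (hmix y i x a b hab ha' hb' ha hb).elim
    · have hx := x.2
      have hy := y.2
      suffices h : i = j ∧ (x : ℕ) = y by rw [h.1, Fin.ext h.2]
      have hpt : ∀ c, c ≠ Sum.inr () → c ∈ u (Sum.inr (i, x)) → c ∈ u (Sum.inr (j, y)) →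
          i = j ∧ (x : ℕ) = y := by
        intro c hc h h'
        rcases ((hu₂ _ _ _).1 h).resolve_left hc with rfl | rfl <;>
          rcases ((hu₂ _ _ _).1 h').resolve_left hc with h | h <;>
          · have := hsum _ (by omega) _ (by omega) _ _ h
            omega
      by_cases ha0 : a = Sum.inr ()
      · exact hpt b (fun h => hab (ha0.trans h.symm)) hb hb'
      · exact hpt a ha0 ha ha'
  · rintro (x | ⟨i, x⟩) a ha b hb hab
    · obtain ⟨l, rfl⟩ := (hu₁ _ _).1 ha
      obtain ⟨l', rfl⟩ := (hu₁ _ _).1 hb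
      exact ⟨fun hl => hab (by rw [show l = l' from hl]), fun _ => (hf₁ l x x.2).symm,
        fun _ => (hf₁ l' x x.2).symm⟩
    · have hd : IsDiagonal f (Sum.inl (((x + k : ℕ) : ZMod (2 * k)), i) : _ ⊕ Unit)
          (Sum.inl (((x : ℕ) : ZMod (2 * k)), i + 1)) := by
        refine ⟨?_, fun _ => (hf₂ i x x.2).symm, ?_⟩ <;> dsimp only <;> intro h <;> omega
      rcases (hu₂ _ _ _).1 ha with rfl | rfl | rfl <;>
        rcases (hu₂ _ _ _).1 hb with rfl | rfl | rfl <;>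
        first
        | exact absurd rfl hab
        | exact hd
        | exact hd.symm
        | trivial
  · simp [ZMod.card]; ring
  · have h := two_mul_card_mixedTriple_index (ZMod (2 * k))
    rw [Fintype.card_sum, ZMod.card] at *
    simp only [Fintype.card_sum, Fintype.card_prod, Fintype.card_fin] at *
    nlinarith

/-- Partial triple systems of order `6 k + 5` which are optimal up to a bounded error. -/
theorem exists_tripleSystem_five_mod_six (k : ℕ) :
    ∃ (I P : Type) (_ : Fintype I) (_ : Fintype P) (t : I → Finset P),
      IsPartialTripleSystem t ∧ Fintype.card P = 6 * k + 5 ∧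
        (6 * k + 5) * (6 * k + 4) ≤ 6 * Fintype.card I + 8 := by
  -- The shift by `1` on the last layer links the vertical triangles of uncovered pairs into a
  -- single cycle through all `6 k + 3` points; `v` runs along it.
  let f : Fin 3 → ZMod (2 * k + 1) → ZMod (2 * k + 1) :=
    fun i x => x * (k + 1 : ℕ) + if i = 2 then 1 else 0
  have hf : ∀ i, Function.Injective (f i) := fun i x y h =>
    ZMod.mul_half_injective k (add_right_cancel h)
  let v : ℕ → ZMod (2 * k + 1) × Fin 3 := fun j => ((j / 3 : ℕ), ⟨j % 3, Nat.mod_lt _ (by omega)⟩)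
  have hv : ∀ a < 6 * k + 3, ∀ b < 6 * k + 3, v a = v b → a = b := by
    intro a ha b hb h
    obtain ⟨h₁, h₂⟩ := Prod.mk.inj h
    have := ZMod.natCast_inj_of_lt (by omega) (by omega) h₁
    have := Fin.mk.inj h₂
    omega
  have hvq : ∀ (q : ℕ) (r : Fin 3), v (3 * q + r) = ((q : ZMod (2 * k + 1)), r) := by
    intro q r
    have hr := r.2
    simp only [v, Prod.mk.injEq, Fin.ext_iff]
    exact ⟨by congr 1; omega, by omega⟩
  have hd : ∀ j, IsDiagonal f (Sum.inl (v j) : _ ⊕ Bool) (Sum.inl (v (j + 1))) := by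
    intro j
    have hh : ∀ q : ℕ, (q : ZMod (2 * k + 1)) = (q + q) * (k + 1 : ℕ) := fun q =>
      (ZMod.add_self_mul_half k q).symm
    obtain ⟨q, rfl | rfl | rfl⟩ : ∃ q, j = 3 * q + (0 : Fin 3) ∨ j = 3 * q + (1 : Fin 3) ∨
        j = 3 * q + (2 : Fin 3) := ⟨j / 3, by simp; omega⟩
    · rw [hvq, show 3 * q + ((0 : Fin 3) : ℕ) + 1 = 3 * q + (1 : Fin 3) from rfl, hvq]
      exact ⟨by simp, fun _ => by simpa [f] using hh q, fun h => absurd h (by simp)⟩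
    · rw [hvq, show 3 * q + ((1 : Fin 3) : ℕ) + 1 = 3 * q + (2 : Fin 3) from rfl, hvq]
      exact ⟨by simp, fun _ => by simpa [f] using hh q, fun h => absurd h (by simp)⟩
    · rw [hvq, show 3 * q + ((2 : Fin 3) : ℕ) + 1 = 3 * (q + 1) + (0 : Fin 3) from rfl, hvq]
      exact ⟨by simp, fun _ => by simpa [f] using hh q, fun h => absurd h (by simp)⟩
  -- The edges along `v` are joined alternately to two extra points, so edges with the same extra
  -- point are disjoint. The cycle is odd, so its closing edge is left out.
  let u : Fin (6 * k + 2) → Finset (ZMod (2 * k + 1) × Fin 3 ⊕ Bool) := fun j =>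
    {Sum.inr (decide ((j : ℕ) % 2 = 0)), Sum.inl (v j), Sum.inl (v (j + 1))}
  have hu : ∀ j a, a ∈ u j ↔ a = Sum.inr (decide ((j : ℕ) % 2 = 0)) ∨ a = Sum.inl (v j) ∨
      a = Sum.inl (v (j + 1)) := fun j a => by simp [u]
  refine ⟨_, _, inferInstance, inferInstance, Sum.elim (mixedTriple Bool f) u,
    isPartialTripleSystem_sumElim hf ⟨?_, ?_⟩ ?_, ?_, ?_⟩
  · intro j
    have hj := j.2
    simp only [u]
    rw [Finset.card_insert_of_notMem (by simp), Finset.card_pair]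
    intro h
    have := hv _ (by omega) _ (by omega) (Sum.inl.inj h)
    omega
  · intro i j a b hab ha hb ha' hb'
    have hi := i.2
    have hj := j.2
    apply Fin.ext
    rcases (hu _ _).1 ha with rfl | rfl | rfl <;> rcases (hu _ _).1 hb with rfl | rfl | rfl <;>
      first
      | exact absurd rfl hab
      | skip
    all_goals
      rcases (hu _ _).1 ha' with h | h | h <;> rcases (hu _ _).1 hb' with h' | h' | h' <;>
      first
      | cases h
      | cases h'
      | exact absurd (h.trans h'.symm) hab
      | skip
    all_goals
      simp only [Sum.inr.injEq, Sum.inl.injEq, decide_eq_decide] at h h'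
      try replace h := hv _ (by omega) _ (by omega) h
      try replace h' := hv _ (by omega) _ (by omega) h'
      omega
  · intro j a ha b hb hab
    rcases (hu _ _).1 ha with rfl | rfl | rfl <;>
      rcases (hu _ _).1 hb with rfl | rfl | rfl <;>
      first
      | exact absurd rfl hab
      | exact hd _
      | exact (hd _).symm
      | trivial
  · simp [ZMod.card]; ring
  · have h := two_mul_card_mixedTriple_index (ZMod (2 * k + 1))
    rw [Fintype.card_sum, ZMod.card] at *
    rw [Fintype.card_fin (6 * k + 2)]
    nlinarith

theorem Odd.exists_tripleSystem {N : ℕ} (hN : Odd N) :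
    ∃ (I P : Type) (_ : Fintype I) (_ : Fintype P) (t : I → Finset P),
      IsPartialTripleSystem t ∧ Fintype.card P = N ∧
        N * (N - 1) ≤ 6 * Fintype.card I + 8 := by
  obtain ⟨r, rfl⟩ := hN
  obtain ⟨k, rfl | rfl | rfl⟩ : ∃ k, r = 3 * k ∨ r = 3 * k + 1 ∨ r = 3 * k + 2 :=
    ⟨r / 3, by omega⟩
  · rcases Nat.eq_zero_or_pos k with rfl | hk
    · exact ⟨Empty, Unit, inferInstance, inferInstance, Empty.elim,
        ⟨fun i => i.elim, fun i => i.elim⟩, rfl, by simp⟩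
    obtain ⟨I, P, hI, hP, t, ht, hc, hle⟩ := exists_tripleSystem_one_mod_six k hk
    refine ⟨I, P, hI, hP, t, ht, by omega, ?_⟩
    rw [show 2 * (3 * k) + 1 = 6 * k + 1 by ring, Nat.add_sub_cancel, hle]
    omega
  · obtain ⟨I, P, hI, hP, t, ht, hc, hle⟩ := exists_tripleSystem_three_mod_six k
    refine ⟨I, P, hI, hP, t, ht, by omega, ?_⟩
    rw [show 2 * (3 * k + 1) + 1 = 6 * k + 2 + 1 by ring, Nat.add_sub_cancel, hle]
    omega
  · obtain ⟨I, P, hI, hP, t, ht, hc, hle⟩ := exists_tripleSystem_five_mod_six k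
    refine ⟨I, P, hI, hP, t, ht, by omega, ?_⟩
    rwa [show 2 * (3 * k + 2) + 1 = 6 * k + 4 + 1 by ring, Nat.add_sub_cancel]

/-! ### Deleting a point. -/

/-- Deleting a point of a partial triple system and renaming the others: the triples through the
deleted point become pairs `{2 r, 2 r + 1}`. -/
theorem IsPartialTripleSystem.exists_deletion {I P : Type} [Fintype I] [Fintype P]
    {t : I → Finset P} (ht : IsPartialTripleSystem t) {n : ℕ} (hP : Fintype.card P = n + 1) :
    ∃ B : I → Finset ℕ, (∀ i, ∀ a ∈ B i, a < n) ∧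
      (∀ i j a b, a ≠ b → a ∈ B i → b ∈ B i → a ∈ B j → b ∈ B j → i = j) ∧
      ∀ i, (B i).card = 3 ∨ ∃ r, B i = {2 * r, 2 * r + 1} := by
  classical
  obtain ⟨p⟩ : Nonempty P := Fintype.card_pos_iff.1 (by omega)
  let M := {i : I // p ∈ t i}
  have hpair : ∀ i : M, ∃ x y, x ≠ y ∧ (t i.1).erase p = {x, y} := fun i =>
    Finset.card_eq_two.1 (by rw [Finset.card_erase_of_mem i.2, ht.card_eq])
  choose x y hxy he using hpair
  have hx : ∀ i, x i ∈ (t i.1).erase p := fun i => by rw [he]; simp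
  have hy : ∀ i, y i ∈ (t i.1).erase p := fun i => by rw [he]; simp
  have huniq : ∀ i j : M, ∀ q, q ∈ (t i.1).erase p → q ∈ (t j.1).erase p → i = j := by
    intro i j q hi hj
    rw [Finset.mem_erase] at hi hj
    exact Subtype.ext (ht.index_unique _ _ q p hi.1 hi.2 i.2 hj.2 j.2)
  let ι : Option (M × Bool) → P := fun o => o.elim p fun q => if q.2 then y q.1 else x q.1
  have hι : ∀ i b, ι (some (i, b)) ∈ (t i.1).erase p := by
    rintro i (_ | _)
    exacts [hx i, hy i]
  have hιinj : Function.Injective ι := by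
    rintro (_ | ⟨i, b⟩) (_ | ⟨j, c⟩) h
    · rfl
    · exact absurd h.symm (Finset.ne_of_mem_erase (hι j c))
    · exact absurd h (Finset.ne_of_mem_erase (hι i b))
    · obtain rfl := huniq i j _ (hι i b) (h ▸ hι j c)
      cases b <;> cases c <;> first | rfl | exact absurd h (hxy i) | exact absurd h (hxy i).symm
  let r := Fintype.equivFin M
  have hM : 2 * Fintype.card M ≤ n := by
    have := Fintype.card_le_of_injective ι hιinj
    rw [Fintype.card_option, Fintype.card_prod, Fintype.card_bool, hP] at this
    omega
  -- Triples through `p` meet only in `p`, so their remainders can be numbered `2 r, 2 r + 1`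
  -- independently. Giving `p` the label `n` leaves labels below `n` for the rest.
  let κ : Option (M × Bool) → ℕ := fun o => o.elim n fun q => 2 * r q.1 + q.2.toNat
  have hκ : ∀ i b, κ (some (i, b)) < n := by
    intro i b
    have h₁ := (r i).2
    have h₂ := b.toNat_le
    change 2 * (r i : ℕ) + b.toNat < n
    omega
  have hκinj : Function.Injective κ := by
    rintro (_ | ⟨i, b⟩) (_ | ⟨j, c⟩) h
    · rfl
    · exact absurd h.symm (hκ j c).ne
    · exact absurd h (hκ i b).ne
    · change 2 * (r i : ℕ) + b.toNat = 2 * (r j : ℕ) + c.toNat at h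
      obtain rfl : i = j := r.injective (Fin.ext (by
        have := b.toNat_le; have := c.toNat_le; omega))
      have : b.toNat = c.toNat := by omega
      cases b <;> cases c <;> simp_all
  have hfι : ∀ o, Function.extend ι κ 0 (ι o) = κ o := fun o => hιinj.extend_apply κ 0 o
  obtain ⟨g, hg⟩ := Finset.exists_equiv_extend_of_card_eq (α := P) (t := Finset.range (n + 1))
    (by rw [hP, Finset.card_range]) (s := Finset.univ.image ι) (f := Function.extend ι κ 0)
    (by
      intro a ha
      simp only [Finset.mem_image, Finset.mem_univ, true_and, exists_exists_eq_and] at ha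
      obtain ⟨o, rfl⟩ := ha
      rw [hfι, Finset.mem_range]
      rcases o with _ | ⟨i, b⟩
      · exact Nat.lt_succ_self n
      · exact (hκ i b).trans (Nat.lt_succ_self n))
    (by
      intro a ha b hb h
      simp only [Finset.coe_image, Finset.coe_univ, Set.image_univ, Set.mem_range] at ha hb
      obtain ⟨o, rfl⟩ := ha
      obtain ⟨o', rfl⟩ := hb
      rw [hfι, hfι] at h
      rw [hκinj h])
  have hgι : ∀ o, (g (ι o) : ℕ) = κ o := fun o => (hg _ (by simp)).trans (hfι o)
  have hgp : (g p : ℕ) = n := hgι none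
  have hginj : ∀ a b, (g a : ℕ) = g b → a = b := fun a b h => g.injective (Subtype.ext h)
  refine ⟨fun i => ((t i).erase p).image fun a => (g a : ℕ), ?_, ?_, ?_⟩
  · intro i a ha
    obtain ⟨q, hq, rfl⟩ := Finset.mem_image.1 ha
    have h₁ := Finset.mem_range.1 (g q).2
    have h₂ : (g q : ℕ) ≠ n := fun h => Finset.ne_of_mem_erase hq (hginj q p (h.trans hgp.symm))
    omega
  · intro i j a b hab ha hb ha' hb'
    obtain ⟨q, hq, rfl⟩ := Finset.mem_image.1 ha
    obtain ⟨s, hs, rfl⟩ := Finset.mem_image.1 hb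
    obtain ⟨q', hq', h⟩ := Finset.mem_image.1 ha'
    obtain ⟨s', hs', h'⟩ := Finset.mem_image.1 hb'
    obtain rfl := hginj _ _ h
    obtain rfl := hginj _ _ h'
    exact ht.index_unique i j q' s' (fun h => hab (by rw [h])) (Finset.mem_of_mem_erase hq)
      (Finset.mem_of_mem_erase hs) (Finset.mem_of_mem_erase hq') (Finset.mem_of_mem_erase hs')
  · intro i
    by_cases hp : p ∈ t i
    · right
      refine ⟨r ⟨i, hp⟩, ?_⟩
      have h₁ : (g (x ⟨i, hp⟩) : ℕ) = 2 * r ⟨i, hp⟩ := hgι (some (⟨i, hp⟩, false))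
      have h₂ : (g (y ⟨i, hp⟩) : ℕ) = 2 * r ⟨i, hp⟩ + 1 := hgι (some (⟨i, hp⟩, true))
      have h₃ : (t i).erase p = _ := he ⟨i, hp⟩
      beta_reduce
      rw [h₃, Finset.image_insert, Finset.image_singleton, h₁, h₂]
    · left
      beta_reduce
      rw [Finset.erase_eq_of_notMem hp, Finset.card_image_of_injective _ (fun a b => hginj a b),
        ht.card_eq]

/-! ### From blocks to color classes. -/

/-- The segment joining two distinct points of `V`. -/
noncomputable def segmentMk {V : Finset Plane} {a b : Plane} (ha : a ∈ V) (hb : b ∈ V) (hab : a ≠ b) :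
    SegmentOf V :=
  ⟨(Set.toFinite ({a, b} : Set Plane)).toFinset, by
    classical
    rw [show (Set.toFinite ({a, b} : Set Plane)).toFinset = {a, b} by ext; simp]
    rw [Finset.mem_powersetCard]
    exact ⟨by rw [Finset.insert_subset_iff, Finset.singleton_subset_iff]; exact ⟨ha, hb⟩,
      Finset.card_pair hab⟩⟩

theorem coe_segmentMk {V : Finset Plane} {a b : Plane} (ha : a ∈ V) (hb : b ∈ V) (hab : a ≠ b) :
    ((segmentMk ha hb hab).1 : Set Plane) = {a, b} := by
  simp [segmentMk]

theorem segmentMk_points {V : Finset Plane} {a b : Plane} (ha : a ∈ V) (hb : b ∈ V)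
    (hab : a ≠ b) : (segmentMk ha hb hab).points = convexHull ℝ {a, b} := by
  rw [SegmentOf.points, coe_segmentMk]

theorem not_disjoint_points_of_mem {V : Finset Plane} {e f : SegmentOf V} {a : Plane}
    (he : a ∈ e.1) (hf : a ∈ f.1) : ¬ Disjoint e.points f.points :=
  Set.not_disjoint_iff.2 ⟨a, subset_convexHull _ _ he, subset_convexHull _ _ hf⟩

/-- Blocks of at most three points, pairwise sharing at most one point, each of them a triple or
an edge of the convex polygon, the edges being disjoint. -/
theorem InConvexPosition.card_le_achromaticNumber {V : Finset Plane} (hV : InConvexPosition V)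
    {I : Type} [Fintype I] {B : I → Finset ℕ} (hlt : ∀ i, ∀ a ∈ B i, a < V.card)
    (huniq : ∀ i j a b, a ≠ b → a ∈ B i → b ∈ B i → a ∈ B j → b ∈ B j → i = j)
    (hB : ∀ i, (B i).card = 3 ∨ ∃ r, B i = {2 * r, 2 * r + 1}) :
    Fintype.card I ≤ achromaticNumber (segmentDisjointnessGraph V) := by
  classical
  obtain ⟨e, he⟩ := hV.exists_enumeration
  let v : ℕ → Plane := fun a => if h : a < V.card then (e ⟨a, h⟩).1 else 0
  have hv : ∀ a (h : a < V.card), v a = (e ⟨a, h⟩).1 := fun a h => dif_pos h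
  have hvV : ∀ a < V.card, v a ∈ V := fun a h => by rw [hv a h]; exact (e ⟨a, h⟩).2
  have hvinj : ∀ a < V.card, ∀ b < V.card, v a = v b → a = b := by
    intro a ha b hb h
    rw [hv a ha, hv b hb] at h
    exact Fin.mk.inj (e.injective (Subtype.ext h))
  have hvne : ∀ a < V.card, ∀ b < V.card, a ≠ b → v a ≠ v b :=
    fun a ha b hb hab h => hab (hvinj a ha b hb h)
  have hor : ∀ a b c, a < b → b < c → c < V.card → 0 < orient (v a) (v b) (v c) := by
    intro a b c hab hbc hc
    rw [hv a (by omega), hv b (by omega), hv c hc]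
    exact he _ _ _ hab hbc
  have hgen : ∀ a < V.card, ∀ b < V.card, ∀ c < V.card, a ≠ b → a ≠ c → b ≠ c →
      orient (v a) (v b) (v c) ≠ 0 := fun a ha b hb c hc hab hac hbc =>
    hV.1.orient_ne_zero (hvV a ha) (hvV b hb) (hvV c hc) (hvne a ha b hb hab)
      (hvne a ha c hc hac) (hvne b hb c hc hbc)
  -- Consecutive points span a polygon edge, with all other points to its left; for `c < 2 * r` this
  -- is cyclic invariance of orientation.
  have hedge : ∀ r c, 2 * r + 1 < V.card → c < V.card → c ≠ 2 * r → c ≠ 2 * r + 1 →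
      0 < orient (v (2 * r)) (v (2 * r + 1)) (v c) := by
    intro r c hr hc h₁ h₂
    rcases lt_or_gt_of_ne h₁ with h | h
    · have := hor c (2 * r) (2 * r + 1) h (by omega) hr
      simp only [orient] at this ⊢; linarith
    · exact hor _ _ _ (by omega) (by omega) hc
  let K : I → Set (SegmentOf V) := fun i => {s | ∀ q ∈ s.1, ∃ a ∈ B i, v a = q}
  have hK : ∀ i a b (ha : a ∈ B i) (hb : b ∈ B i) (hab : a ≠ b),
      segmentMk (hvV a (hlt i a ha)) (hvV b (hlt i b hb))
        (hvne a (hlt i a ha) b (hlt i b hb) hab) ∈ K i := by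
    intro i a b ha hb hab q hq
    rw [← Finset.mem_coe, coe_segmentMk] at hq
    rcases hq with rfl | rfl
    exacts [⟨a, ha, rfl⟩, ⟨b, hb, rfl⟩]
  have hcard : ∀ i, 2 ≤ (B i).card ∧ (B i).card ≤ 3 := by
    intro i
    rcases hB i with h | ⟨r, h⟩
    · omega
    · rw [h, Finset.card_pair (by omega)]; omega
  -- The excluded case is an edge `i` against a triangle `j`, where the edge may have an endpoint in
  -- common with the triangle; there the roles are exchanged.
  have hout : ∀ i j, i ≠ j → (B i).card = 3 ∨ (∃ r s, B i = {2 * r, 2 * r + 1} ∧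
      B j = {2 * s, 2 * s + 1}) → ∃ a ∈ B i, ∃ b ∈ B i, a ≠ b ∧ a ∉ B j ∧ b ∉ B j := by
    rintro i j hij (h | ⟨r, s, hr, hs⟩)
    · have h₁ : (B i ∩ B j).card ≤ 1 := by
        rw [Finset.card_le_one]
        intro a ha b hb
        rw [Finset.mem_inter] at ha hb
        by_contra hab
        exact hij (huniq i j a b hab ha.1 hb.1 ha.2 hb.2)
      have h₂ := Finset.card_sdiff_add_card_inter (B i) (B j)
      obtain ⟨a, ha, b, hb, hab⟩ := Finset.one_lt_card.1 (by omega : 1 < (B i \ B j).card)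
      rw [Finset.mem_sdiff] at ha hb
      exact ⟨a, ha.1, b, hb.1, hab, ha.2, hb.2⟩
    · have hrs : r ≠ s := by
        rintro rfl
        exact hij (huniq i j (2 * r) (2 * r + 1) (by omega) (by simp [hr]) (by simp [hr])
          (by simp [hs]) (by simp [hs]))
      refine ⟨2 * r, by simp [hr], 2 * r + 1, by simp [hr], by omega, ?_, ?_⟩ <;>
        · rw [hs, Finset.mem_insert, Finset.mem_singleton]; omega
  have hedge_adj : ∀ i j, i ≠ j → (∃ r, B j = {2 * r, 2 * r + 1}) →
      ∃ s ∈ K i, ∃ s' ∈ K j, Disjoint s.points s'.points := by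
    rintro i j hij ⟨r, hr⟩
    obtain ⟨a, ha, b, hb, hab, haj, hbj⟩ := hout i j hij
      ((hB i).imp_right fun ⟨r', hr'⟩ => ⟨r', r, hr', hr⟩)
    have h₀ : 2 * r ∈ B j := by simp [hr]
    have h₁ : 2 * r + 1 ∈ B j := by simp [hr]
    refine ⟨_, hK i a b ha hb hab, _, hK j _ _ h₀ h₁ (by omega), ?_⟩
    rw [segmentMk_points, segmentMk_points]
    rw [hr, Finset.mem_insert, Finset.mem_singleton, not_or] at haj hbj
    exact (disjoint_convexHull_pair_of_orient_pos
      (hedge r a (hlt j _ h₁) (hlt i a ha) haj.1 haj.2)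
      (hedge r b (hlt j _ h₁) (hlt i b hb) hbj.1 hbj.2)).symm
  refine _root_.card_le_achromaticNumber _ K ?_ ?_ ?_ ?_
  · intro i
    obtain ⟨a, ha, b, hb, hab⟩ := Finset.one_lt_card.1 (hcard i).1
    exact ⟨_, hK i a b ha hb hab⟩
  · intro i j s hi hj
    obtain ⟨p, q, hpq, hs⟩ := Finset.card_eq_two.1 (Finset.mem_powersetCard.1 s.2).2
    obtain ⟨a, ha, hap⟩ := hi p (by simp [hs])
    obtain ⟨b, hb, hbq⟩ := hi q (by simp [hs])
    obtain ⟨a', ha', hap'⟩ := hj p (by simp [hs])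
    obtain ⟨b', hb', hbq'⟩ := hj q (by simp [hs])
    obtain rfl := hvinj a (hlt i a ha) a' (hlt j a' ha') (hap.trans hap'.symm)
    obtain rfl := hvinj b (hlt i b hb) b' (hlt j b' hb') (hbq.trans hbq'.symm)
    exact huniq i j a b (by rintro rfl; exact hpq (hap.symm.trans hbq)) ha hb ha' hb'
  · intro i s hs s' hs' hadj
    have h₁ : s.1 ⊆ (B i).image v := fun q hq => Finset.mem_image.2 (hs q hq)
    have h₂ : s'.1 ⊆ (B i).image v := fun q hq => Finset.mem_image.2 (hs' q hq)
    have h₃ := Finset.card_le_card (Finset.union_subset h₁ h₂)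
    have h₄ : ((B i).image v).card ≤ 3 := Finset.card_image_le.trans (hcard i).2
    have h₅ := Finset.card_union_add_card_inter s.1 s'.1
    have h₆ := (Finset.mem_powersetCard.1 s.2).2
    have h₇ := (Finset.mem_powersetCard.1 s'.2).2
    -- Two pairs inside a set of at most three points share a point.
    obtain ⟨q, hq⟩ := Finset.card_pos.1 (by omega : 0 < (s.1 ∩ s'.1).card)
    rw [Finset.mem_inter] at hq
    exact not_disjoint_points_of_mem hq.1 hq.2 hadj
  · intro i j hij
    rcases hB j with hj | hj
    · rcases hB i with hi | hi
      · obtain ⟨a, ha, b, hb, hab, haj, hbj⟩ := hout i j hij (Or.inl hi)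
        obtain ⟨p, q, r, hpq, hpr, hqr, hBj⟩ := Finset.card_eq_three.1 hj
        have hp : p ∈ B j := by simp [hBj]
        have hq : q ∈ B j := by simp [hBj]
        have hr : r ∈ B j := by simp [hBj]
        have hne : ∀ x ∈ B j, orient (v a) (v b) (v x) ≠ 0 := fun x hx =>
          hgen a (hlt i a ha) b (hlt i b hb) x (hlt j x hx) hab
            (fun h => haj (h ▸ hx)) (fun h => hbj (h ▸ hx))
        have hfin : ∀ x ∈ B j, ∀ y ∈ B j, x ≠ y →
            0 < orient (v a) (v b) (v x) * orient (v a) (v b) (v y) →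
            ∃ s ∈ K i, ∃ s' ∈ K j, (segmentDisjointnessGraph V).Adj s s' := by
          intro x hx y hy hxy h
          refine ⟨_, hK i a b ha hb hab, _, hK j x y hx hy hxy, ?_⟩
          change Disjoint (SegmentOf.points _) (SegmentOf.points _)
          rw [segmentMk_points, segmentMk_points]
          exact disjoint_convexHull_pair_of_orient_mul_pos h
        rcases exists_side_disjoint (hne p hp) (hne q hq) (hne r hr) with h | h | h
        exacts [hfin p hp q hq hpq h, hfin p hp r hr hpr h, hfin q hq r hr hqr h]
      · obtain ⟨s, hs, s', hs', h⟩ := hedge_adj j i hij.symm hi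
        exact ⟨s', hs', s, hs, h.symm⟩
    · exact hedge_adj i j hij hj

theorem theorem7p4 :
    ∃ g : ℕ → ℝ,
      (∃ c : ℝ, 0 < c ∧ ∃ C : ℝ, ∀ᶠ n : ℕ in Filter.atTop, c * (n : ℝ) ≤ g n ∧ g n ≤ C * (n : ℝ)) ∧
      ∀ n : ℕ, Even n → ∀ V : Finset Plane, V.card = n → InConvexPosition V →
        (n : ℝ) ^ 2 / 6 + g n ≤ (achromaticNumber (segmentDisjointnessGraph V) : ℝ) := by
  -- This is `((n + 1) n - 8) / 6 - n ^ 2 / 6`; it is at least `n / 12` exactly when `n ≥ 16`.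
  refine ⟨fun n => n / 6 - 8 / 6, ⟨1 / 12, by norm_num, 1, ?_⟩, ?_⟩
  · filter_upwards [Filter.eventually_ge_atTop 16] with n hn
    have : (16 : ℝ) ≤ n := by exact_mod_cast hn
    constructor <;> linarith
  · intro n hn V hVn hV
    obtain ⟨I, P, _, _, t, ht, hP, hle⟩ := hn.add_one.exists_tripleSystem
    obtain ⟨B, hlt, huniq, hB⟩ := ht.exists_deletion hP
    have hI := hV.card_le_achromaticNumber (by rwa [hVn]) huniq hB
    have h₁ : (n + 1) * n ≤ 6 * achromaticNumber (segmentDisjointnessGraph V) + 8 := by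
      rw [Nat.add_sub_cancel] at hle; omega
    have h₂ : ((n : ℝ) + 1) * n ≤ 6 * achromaticNumber (segmentDisjointnessGraph V) + 8 := by
      exact_mod_cast h₁
    linarith
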